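/- Write $H_d$ for the set of functions $h(x)=\langle x,v\rangle+b$ on $\mathbb{R}^d$ with $v\in\mathbb{R}^d$, $\|v\|=1$, $b\in\mathbb{R}$ (oriented, not necessarily homogeneous hyperplanes). For $h\in H_d$, a label query on $x$ returns $\mathrm{sign}(h(x))$ and a comparison query on $x,y$ returns $\mathrm{sign}(h(x)-h(y))$. A set $T\subseteq\mathbb{R}^d$ infers a point $x$ under $h$, written $T\to_h x$, if every $h'\in H_d$ that gives the same answers as $h$ to all label and comparison queries on points of $T$ satisfies $\mathrm{sign}(h'(x))=\mathrm{sign}(h(x))$. For a probability distribution $D$ on $\mathbb{R}^d$, we say that $(D,\mathbb{R}^d,H_d)$ has average inference dimension $g(n)$ if for every $n$ and every $h\in H_d$ $$\Pr_{(x_1,\dots,x_n)\sim D^n}\bigl[\,\text{there is no } i \text{ with } \{x_j : j\neq i\}\to_h x_i\,\bigr]\le g(n).$$ Two distributions $D,D'$ on $\mathbb{R}^d$ are affinely equivalent if $D'$ is the image of $D$ under an invertible affine map of $\mathbb{R}^d$. Theorem. There are absolute constants $A,B>0$ such that the following holds for all $d\ge 1$ and all real $c_1,c_2$. Let $D$ be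 a probability distribution on $\mathbb{R}^d$ that is affinely equivalent to a distribution $D'$ with 1. $\Pr_{x\sim D'}[\|x\|>d\alpha]\le c_1/\alpha$ for all $\alpha>0$, and 2. $\Pr_{x\sim D'}[|\langle x,v\rangle+b|\le\alpha]\le c_2\alpha$ for all $\alpha>0$, all unit vectors $v$ and all $b\in\mathbb{R}$. Then $(D,\mathbb{R}^d,H_d)$ has, under label and comparison queries, an average inference dimension $g(n)$ such that $$g(n)\le 2^{-B\,n^2/(d\log(d+1))}\qquad\text{for all } n\ge A\,\log(2+c_1+c_2)\; d\log^2(d+1).$$ (That is, $g(n)\le 2^{-\Omega(n^2/(d\log d))}$ for $n=\Omega(d\log^2 d)$, where the constant in the condition on $n$ depends logarithmically on $c_1,c_2$.) -/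

import Mathlib

namespace AvgInference

/-- `ℝ^d` with its Euclidean norm. -/
abbrev Pt (d : ℕ) : Type := EuclideanSpace ℝ (Fin d)

/-- The class `H_d` of (not necessarily homogeneous) oriented hyperplanes `x ↦ ⟨x, v⟩ + b` of `ℝ^d`,
each written with a unit normal vector, so that `|h x|` is the distance from `x` to the hyperplane.
The answers to label and comparison queries do not change under positive rescaling of `h`. -/
def hyperplanes (d : ℕ) : Set (Pt d → ℝ) :=
  {h | ∃ (v : Pt d) (b : ℝ), ‖v‖ = 1 ∧ h = fun x => inner ℝ x v + b}

/-- `h` and `h'` give the same answers to all label queries `sign (h x)` and all comparison queries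
`sign (h x - h y)` on the points of `T`. -/
def SameAnswers {X : Type*} (T : Set X) (h h' : X → ℝ) : Prop :=
  (∀ x ∈ T, SignType.sign (h' x) = SignType.sign (h x)) ∧
  (∀ x ∈ T, ∀ y ∈ T, SignType.sign (h' x - h' y) = SignType.sign (h x - h y))

/-- `T` infers `x` under `h` (`T →_h x`) relative to the class `H`: the answers to all label and
comparison queries on `T` under `h` determine the label of `x`. -/
def Infers {X : Type*} (H : Set (X → ℝ)) (h : X → ℝ) (T : Set X) (x : X) : Prop :=
  ∀ h' ∈ H, SameAnswers T h h' → SignType.sign (h' x) = SignType.sign (h x)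

/-- `(D, X, H)` has average inference dimension `g` (label and comparison queries): for every
`h ∈ H` and every `n`, a sample of `n` independent points of law `D` contains no point that is
inferred under `h` by the other points of the sample with probability at most `g n`. -/
def HasAverageInferenceDimension {X : Type*} [MeasurableSpace X]
    (D : MeasureTheory.Measure X) (H : Set (X → ℝ)) (g : ℕ → ℝ) : Prop :=
  ∀ n : ℕ, ∀ h ∈ H,
    (MeasureTheory.Measure.pi (fun _ : Fin n => D)).real
      {S : Fin n → X | ¬ ∃ i : Fin n, Infers H h (S '' {j | j ≠ i}) (S i)} ≤ g n

/-- `D` and `D'` are affinely equivalent: an invertible affine map carries `D` to `D'`. -/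
def AffinelyEquivalent {d : ℕ} (D D' : MeasureTheory.Measure (Pt d)) : Prop :=
  ∃ f : Pt d ≃ᵃ[ℝ] Pt d, D.map f = D'

/-- Concentration: `Pr[‖x‖ > d α] ≤ c₁ / α` for all `α > 0`. -/
def Concentrated {d : ℕ} (D : MeasureTheory.Measure (Pt d)) (c₁ : ℝ) : Prop :=
  ∀ α : ℝ, 0 < α → D.real {x | (d : ℝ) * α < ‖x‖} ≤ c₁ / α

/-- Anti-concentration: `Pr[|⟨x, v⟩ + b| ≤ α] ≤ c₂ α` for all `α > 0` and all hyperplanes. -/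
def AntiConcentrated {d : ℕ} (D : MeasureTheory.Measure (Pt d)) (c₂ : ℝ) : Prop :=
  ∀ α : ℝ, 0 < α → ∀ h ∈ hyperplanes d, D.real {x | |h x| ≤ α} ≤ c₂ * α

end AvgInference

/-! Work on one side of `h` and sort by `h`. Greedily pick low points `b 0, …, b d` spanning a
simplex with heights at least `η`; let `v 0, …, v K` be other points in increasing order, all above
the simplex vertices. The `2 ^ K` subset sums of the differences `v (i + 1) - v i` lie in a box too
small to hold disjoint translates of a small parallelepiped on the simplex edges. So some nonzero
combination of differences with coefficients in `{-1, 0, 1}` is a combination of edges with tiny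
coefficients (`IsFlag.exists_sign_relation`). If `q` is the last index used, this bounds `v (q + 1)`
below by `v 0` up to a small error, so its positivity follows from answers on the other points
(`exists_forced_pos`). This fails only if some `(d + 1)`-tuple of sample points leaves many others
far out, on the zero set of `h`, or near a span of the tuple. Given the tuple, the others are
independent and each is bad with probability at most some small `q`; a union bound gives `n ^ (d +
1) * 2 ^ n * q ^ k`. With `η = 2 ^ (-n / (64 d))` and `k` about `n / 8`, this is `2 ^ (-Ω(n ^ 2 /
d))`. The argument rules out every affine function, not only normalized ones, so it survives affine
equivalence. -/

namespace AvgInference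

/-! ### Volume pigeonhole and forced signs. -/

/-- Volume pigeonhole: more translates of a parallelepiped than fit into a box must overlap. -/
theorem exists_ne_sub_eq_mulVec {d : ℕ} {ι : Type*} [Fintype ι] (y : ι → Fin d → ℝ)
    (M : Matrix (Fin d) (Fin d) ℝ) {ρ a ε : ℝ} (hρ : 0 ≤ ρ) (ha : 0 ≤ a) (hε : 0 ≤ ε)
    (hy : ∀ i s, |y i s| ≤ ρ) (hM : ∀ s t, |M s t| ≤ a)
    (hcard : (2 * (ρ + d * (a * ε))) ^ d < Fintype.card ι * (|M.det| * ε ^ d)) :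
    ∃ i j, i ≠ j ∧ ∃ β : Fin d → ℝ, (∀ s, |β s| ≤ ε) ∧ y i - y j = M.mulVec β := by
  classical
  set box : Set (Fin d → ℝ) := Set.Icc 0 (fun _ => ε)
  set C : ι → Set (Fin d → ℝ) := fun i => (fun z => y i + z) '' (Matrix.toLin' M '' box)
  have hcompact : ∀ i, IsCompact (C i) := fun i =>
    (isCompact_Icc.image (LinearMap.continuous_of_finiteDimensional _)).image (by fun_prop)
  have hvol : ∀ i, MeasureTheory.volume (C i) = ENNReal.ofReal (|M.det| * ε ^ d) := by
    intro i
    simp only [C]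
    rw [Set.image_add_left, MeasureTheory.measure_preimage_add,
      MeasureTheory.Measure.addHaar_image_linearMap, LinearMap.det_toLin', Real.volume_Icc_pi,
      ENNReal.ofReal_mul (abs_nonneg _)]
    simp [ENNReal.ofReal_pow hε]
  set w : ℝ := ρ + d * (a * ε)
  have hw : 0 ≤ w := by positivity
  have hsub : ∀ i, C i ⊆ Set.Icc (fun _ => -w) (fun _ => w) := by
    rintro i _ ⟨_, ⟨z, hz, rfl⟩, rfl⟩
    have hz' : ∀ t, |z t| ≤ ε := fun t => by
      rw [abs_of_nonneg (hz.1 t)]; exact hz.2 t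
    have key : ∀ s, |(y i + Matrix.toLin' M z) s| ≤ w := by
      intro s
      rw [Matrix.toLin'_apply, Pi.add_apply]
      refine (abs_add_le _ _).trans (add_le_add (hy i s) ?_)
      change |∑ t, M s t * z t| ≤ _
      refine (Finset.abs_sum_le_sum_abs _ _).trans ?_
      refine (Finset.sum_le_card_nsmul _ _ (a * ε) fun t _ => ?_).trans (by simp)
      rw [abs_mul]
      exact mul_le_mul (hM s t) (hz' t) (abs_nonneg _) ha
    exact ⟨fun s => (abs_le.1 (key s)).1, fun s => (abs_le.1 (key s)).2⟩
  have hinter : ∃ i j, i ≠ j ∧ (C i ∩ C j).Nonempty := by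
    by_contra hno
    have hdisj : ((Finset.univ : Finset ι) : Set ι).PairwiseDisjoint C := by
      intro i _ j _ hij
      exact Set.disjoint_iff_inter_eq_empty.2
        (Set.not_nonempty_iff_eq_empty.1 fun h => hno ⟨i, j, hij, h⟩)
    have h1 := MeasureTheory.measure_biUnion_finset (μ := MeasureTheory.volume) hdisj
      (fun i _ => (hcompact i).measurableSet)
    have h2 : MeasureTheory.volume (⋃ i ∈ (Finset.univ : Finset ι), C i)
        ≤ MeasureTheory.volume (Set.Icc (fun _ : Fin d => -w) (fun _ => w)) :=
      MeasureTheory.measure_mono (Set.iUnion₂_subset fun i _ => hsub i)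
    rw [h1, Real.volume_Icc_pi] at h2
    simp only [hvol, Finset.sum_const, Finset.prod_const, Finset.card_univ, Fintype.card_fin,
      nsmul_eq_mul] at h2
    rw [← ENNReal.ofReal_natCast, ← ENNReal.ofReal_mul (by positivity),
      ← ENNReal.ofReal_pow (by linarith), ENNReal.ofReal_le_ofReal_iff (by
        apply pow_nonneg; linarith)] at h2
    have : w - -w = 2 * w := by ring
    rw [this] at h2
    exact absurd hcard (not_lt.2 h2)
  obtain ⟨i, j, hij, _, ⟨_, ⟨z, hz, rfl⟩, rfl⟩, ⟨_, ⟨z', hz', rfl⟩, he⟩⟩ := hinter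
  refine ⟨i, j, hij, z' - z, fun s => ?_, ?_⟩
  · have h1 := hz.1 s; have h2 := hz.2 s; have h3 := hz'.1 s; have h4 := hz'.2 s
    simp only [Pi.zero_apply] at h1 h3
    rw [Pi.sub_apply, abs_le]; constructor <;> linarith
  · simp only [Matrix.toLin'_apply] at he
    rw [Matrix.mulVec_sub, sub_eq_sub_iff_add_eq_add, ← he, add_comm]

/-- `b 0, …, b d` form a simplex whose successive heights, measured in the directions `e s`, are at
least `η`. -/
structure IsFlag {d : ℕ} (η : ℝ) (b : Fin (d + 1) → Pt d) (e : Fin d → Pt d) : Prop where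
  norm_eq_one : ∀ s, ‖e s‖ = 1
  inner_eq_zero : ∀ s t, t < s → inner ℝ (b t.succ - b 0) (e s) = 0
  le_abs_inner : ∀ s, η ≤ |inner ℝ (b s.succ - b 0) (e s)|

/-- Among many vectors some nontrivial `{-1, 0, 1}`-combination is a combination with small
coefficients of the edges of a flag. -/
theorem IsFlag.exists_sign_relation {d : ℕ} {η R ε r : ℝ} {b : Fin (d + 1) → Pt d}
    {e : Fin d → Pt d} (hb : IsFlag η b e) (hη : 0 < η) (hR : 0 ≤ R) (hε : 0 < ε) (hr : 0 ≤ r)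
    (hbR : ∀ s, ‖b s‖ ≤ R) {K : ℕ} (v : ℕ → Pt d) (hv : ∀ i < K, ‖v i‖ ≤ r)
    (hcard : (2 * (K * r + d * (2 * R * ε))) ^ d < 2 ^ K * (η * ε) ^ d) :
    ∃ α : ℕ → ℝ, (∀ i, α i = -1 ∨ α i = 0 ∨ α i = 1) ∧ (∃ i < K, α i ≠ 0) ∧
      ∃ β : Fin d → ℝ, (∀ s, |β s| ≤ ε) ∧
        ∑ i ∈ Finset.range K, α i • v i = ∑ s, β s • (b s.succ - b 0) := by
  classical
  -- Coordinates are inner products with the `e s`: the edge matrix becomes triangular, its diagonal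
  -- entries being the heights.
  set M : Matrix (Fin d) (Fin d) ℝ := fun s t => inner ℝ (b t.succ - b 0) (e s)
  have htri : M.IsUpperTriangular := fun s t hst => hb.inner_eq_zero s t hst
  have hdet : η ^ d ≤ |M.det| := by
    rw [Matrix.det_of_isUpperTriangular htri, Finset.abs_prod]
    calc η ^ d = ∏ _s : Fin d, η := by simp
      _ ≤ _ := Finset.prod_le_prod (fun _ _ => hη.le) fun s _ => hb.le_abs_inner s
  -- The `e s` need not be orthonormal, but they separate points: `M` is invertible and factors
  -- through them.
  have hEz : ∀ z : Pt d, (∀ s, inner ℝ z (e s) = 0) → z = 0 := by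
    intro z hz
    set E : Matrix (Fin d) (Fin d) ℝ := fun s i => e s i
    set F : Matrix (Fin d) (Fin d) ℝ := fun i t => (b t.succ - b 0) i
    have hEF : E * F = M := by
      ext s t
      rw [Matrix.mul_apply]
      simp [E, F, M, PiLp.inner_apply]
    have hdetE : IsUnit E := by
      rw [Matrix.isUnit_iff_isUnit_det, isUnit_iff_ne_zero]
      intro h0
      have : M.det = 0 := by rw [← hEF, Matrix.det_mul, h0, zero_mul]
      rw [this, abs_zero] at hdet
      exact absurd (pow_pos hη d) (not_lt.2 hdet)
    have hinj := Matrix.mulVec_injective_iff_isUnit.2 hdetE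
    have : (fun i => z i) = (0 : Fin d → ℝ) := by
      apply hinj
      rw [Matrix.mulVec_zero]
      ext s
      have := hz s
      simpa [Matrix.mulVec, dotProduct, E, PiLp.inner_apply] using this
    ext i
    exact congrFun this i
  set f : Finset (Fin K) → Pt d := fun σ => ∑ i ∈ σ, v i
  have hf : ∀ σ, ‖f σ‖ ≤ K * r := by
    intro σ
    refine (norm_sum_le σ fun i : Fin K => v i).trans ?_
    refine (Finset.sum_le_card_nsmul σ _ r fun i _ => hv i i.2).trans ?_
    rw [nsmul_eq_mul]
    gcongr
    simpa using Finset.card_le_univ σ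
  have habs : ∀ (z : Pt d) s, |inner ℝ z (e s)| ≤ ‖z‖ := fun z s => by
    simpa [hb.norm_eq_one s] using abs_real_inner_le_norm z (e s)
  obtain ⟨σ, τ, hne, β, hβ, heq⟩ := exists_ne_sub_eq_mulVec
    (fun (σ : Finset (Fin K)) s => inner ℝ (f σ) (e s)) M (ρ := K * r) (a := 2 * R) (ε := ε)
    (by positivity) (by positivity) hε.le (fun σ s => (habs _ s).trans (hf σ))
    (fun s t => (habs _ s).trans ((norm_sub_le _ _).trans (by
      linarith [hbR t.succ, hbR 0]))) (by
      refine hcard.trans_le ?_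
      rw [mul_pow]
      simp only [Fintype.card_finset, Fintype.card_fin]
      push_cast
      gcongr)
  set γ : Fin K → ℝ := fun i => (if i ∈ σ then 1 else 0) - (if i ∈ τ then 1 else 0)
  have hfσ : ∀ σ, f σ = ∑ i : Fin K, (if i ∈ σ then (1 : ℝ) else 0) • v i := by
    intro σ
    simp [f, Finset.sum_ite_mem]
  have hγ : ∑ i : Fin K, γ i • v i = f σ - f τ := by
    rw [hfσ σ, hfσ τ, ← Finset.sum_sub_distrib]
    exact Finset.sum_congr rfl fun i _ => sub_smul _ _ _
  refine ⟨fun i => if h : i < K then γ ⟨i, h⟩ else 0, ?_, ?_, β, hβ, ?_⟩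
  · intro i
    by_cases h : i < K
    · simp only [h, dif_pos, γ]
      split_ifs <;> norm_num
    · simp [h]
  · by_contra hno
    push Not at hno
    apply hne
    ext i
    have := hno i i.2
    simp only [i.2, dif_pos, γ] at this
    by_cases h1 : i ∈ σ <;> by_cases h2 : i ∈ τ <;> simp [h1, h2] at this ⊢
  · rw [Finset.sum_range]
    simp only [Fin.is_lt, dif_pos, Fin.eta]
    rw [hγ, ← sub_eq_zero]
    apply hEz
    intro s
    have := congrFun heq s
    simp only [Pi.sub_apply, Matrix.mulVec, dotProduct, M] at this
    rw [inner_sub_left, inner_sub_left, this, sum_inner, sub_eq_zero]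
    exact Finset.sum_congr rfl fun t _ => by rw [real_inner_smul_left, mul_comm]

/-- A relation among consecutive differences of a chain forces positivity of one of its members for
every functional that is positive and monotone on the rest. -/
theorem exists_forced_pos {d : ℕ} {V : Type*} [AddCommGroup V] [Module ℝ V]
    {b : Fin (d + 1) → V} {K : ℕ} {v : ℕ → V} {α : ℕ → ℝ} {β : Fin d → ℝ}
    (hα : ∀ i, α i = -1 ∨ α i = 0 ∨ α i = 1) (hne : ∃ i < K, α i ≠ 0)
    (hβ : ∑ s, |β s| ≤ 1 / 2)
    (hrel : ∑ i ∈ Finset.range K, α i • (v (i + 1) - v i) = ∑ s, β s • (b s.succ - b 0)) :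
    ∃ p ≤ K, ∀ (l : V →ₗ[ℝ] ℝ) (c : ℝ),
      (∀ s, 0 < l (b s) + c) → (∀ s, ∀ i ≤ K, i ≠ p → l (b s) ≤ l (v i)) →
      (∀ i ≤ K, ∀ j ≤ K, i ≠ p → j ≠ p → i ≤ j → l (v i) ≤ l (v j)) → 0 < l (v p) + c := by
  classical
  set s := (Finset.range K).filter fun i => α i ≠ 0
  have hs : s.Nonempty := by
    obtain ⟨i, hi, h⟩ := hne
    exact ⟨i, by simp [s, hi, h]⟩
  set q := s.max' hs
  have hq : q < K ∧ α q ≠ 0 := by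
    have h := s.max'_mem hs
    rwa [Finset.mem_filter, Finset.mem_range] at h
  have htop : ∀ i < K, q < i → α i = 0 := by
    intro i hi hqi
    by_contra h
    exact absurd (s.le_max' i (by simp [s, hi, h])) (not_le.2 hqi)
  -- `v (q + 1)` enters only the last nonzero term, so the rest of the relation involves known
  -- points alone.
  refine ⟨q + 1, hq.1, fun l c hpos hb hmono => ?_⟩
  have hR : ∑ i ∈ Finset.range (q + 1), α i * (l (v (i + 1)) - l (v i))
      = ∑ s, β s * (l (b s.succ) - l (b 0)) := by
    have h := congrArg l hrel
    simp only [map_sum, map_smul, map_sub, smul_eq_mul] at h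
    rw [← h]
    apply Finset.sum_subset
    · intro i; simp; have := hq.1; omega
    · intro i h1 h2
      rw [htop i (by simpa using h1) (by simp at h2; omega), zero_mul]
  rw [Finset.sum_range_succ] at hR
  have h0 : ∀ s, l (b s) ≤ l (v 0) := fun s => hb s 0 (by omega) (by omega)
  set w := l (v 0) + c
  have hw : 0 < w := (hpos 0).trans_le (by simpa [w] using h0 0)
  -- At all flag vertices `l + c` lies in `(0, w]`, so each edge changes `l` by less than `w`.
  have herr : |∑ s, β s * (l (b s.succ) - l (b 0))| ≤ 1 / 2 * w := by
    refine (Finset.abs_sum_le_sum_abs _ _).trans ?_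
    refine le_trans ?_ (mul_le_mul_of_nonneg_right hβ hw.le)
    rw [Finset.sum_mul]
    refine Finset.sum_le_sum fun s _ => ?_
    rw [abs_mul]
    refine mul_le_mul_of_nonneg_left ?_ (abs_nonneg _)
    have h1 := hpos s.succ; have h2 := hpos 0; have h3 := h0 s.succ; have h4 := h0 0
    simp only [w]
    rw [abs_le]; constructor <;> linarith
  -- The lower differences are nonnegative and telescope.
  have hlow : |∑ i ∈ Finset.range q, α i * (l (v (i + 1)) - l (v i))| ≤ l (v q) - l (v 0) := by
    rw [← Finset.sum_range_sub (fun i => l (v i)) q]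
    refine (Finset.abs_sum_le_sum_abs _ _).trans (Finset.sum_le_sum fun i hi => ?_)
    have hi' : i < q := by simpa using hi
    have hd := hmono i (by omega) (i + 1) (by omega) (by omega) (by omega) (by omega)
    rw [abs_mul, abs_of_nonneg (sub_nonneg.2 hd)]
    have : |α i| ≤ 1 := by rcases hα i with h | h | h <;> simp [h]
    exact mul_le_of_le_one_left (sub_nonneg.2 hd) this
  rw [abs_le] at herr hlow
  simp only [w] at *
  -- For either sign, `l (v (q + 1)) + c ≥ w - w / 2 > 0`.
  rcases hα q with h | h | h
  · rw [h] at hR; linarith [herr.1, herr.2, hlow.1, hlow.2]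
  · exact absurd h hq.2
  · rw [h] at hR; linarith [herr.1, herr.2, hlow.1, hlow.2]


/-! ### Greedy flags and bad points. -/

/-- The points at distance less than `η`, in every admissible direction, from the affine span of
`b 0, …, b s`. -/
def nearFlag {d : ℕ} (η : ℝ) (b : Fin (d + 1) → Pt d) (s : Fin d) : Set (Pt d) :=
  {x | ∀ e : Pt d, ‖e‖ = 1 → (∀ t < s, inner ℝ (b t.succ - b 0) e = 0) → |inner ℝ (x - b 0) e| < η}

/-- The points that are far from the origin, on the zero set of `h`, or near one of the spans of
`b`. -/
def badRegion {d : ℕ} (η R : ℝ) (h : Pt d → ℝ) (b : Fin (d + 1) → Pt d) : Set (Pt d) :=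
  {x | R < ‖x‖ ∨ h x = 0 ∨ ∃ s, x ∈ nearFlag η b s}

theorem nearFlag_congr {d : ℕ} {η : ℝ} {b b' : Fin (d + 1) → Pt d} {s : Fin d} (h0 : b 0 = b' 0)
    (h : ∀ t < s, b t.succ = b' t.succ) : nearFlag η b s = nearFlag η b' s := by
  ext x
  simp only [nearFlag, Set.mem_ofPred_eq]
  refine forall_congr' fun e => forall_congr' fun _ => ?_
  rw [h0]
  have : (∀ t < s, inner ℝ (b t.succ - b' 0) e = 0) ↔ ∀ t < s, inner ℝ (b' t.succ - b' 0) e = 0 :=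
    forall_congr' fun t => forall_congr' fun ht => by rw [h t ht]
  rw [this]

/-- Any finite set of points has a flag whose vertices come before all points that are far from the
spans of the flag. -/
theorem exists_greedy_flag {d : ℕ} {ι : Type*} [DecidableEq ι] (η : ℝ) (X : ι → Pt d) (f : ι → ℝ)
    (A : Finset ι) (hA : A.Nonempty) :
    ∃ b : Fin (d + 1) → ι, ∀ V ⊆ A, V.Nonempty →
      (∀ j ∈ V, ∀ s, X j ∉ nearFlag η (X ∘ b) s) →
      (∀ s, b s ∈ A) ∧ (∀ s, ∀ j ∈ V, f (b s) ≤ f j) ∧ ∃ e, IsFlag η (X ∘ b) e := by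
  classical
  obtain ⟨a, haA, ha⟩ := A.exists_min_image f hA
  -- Vertices are chosen one at a time, each lowest among the points far from the span so far. The
  -- choice cannot depend on `V`, which is known only after `b`.
  have hstep : ∀ m ≤ d, ∃ b : Fin (d + 1) → ι, b 0 = a ∧ ∀ s : Fin d, (s : ℕ) < m →
      ∀ j ∈ A, X j ∉ nearFlag η (X ∘ b) s →
        b s.succ ∈ A ∧ X (b s.succ) ∉ nearFlag η (X ∘ b) s ∧ f (b s.succ) ≤ f j := by
    intro m
    induction m with
    | zero => exact fun _ => ⟨fun _ => a, rfl, fun s hs => absurd hs (by omega)⟩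
    | succ m ih =>
      intro hm
      obtain ⟨b, hb0, hb⟩ := ih (by omega)
      set s₀ : Fin d := ⟨m, by omega⟩
      set N := A.filter fun j => X j ∉ nearFlag η (X ∘ b) s₀
      -- If no far point is left, `y = a` is a dummy and the claim is vacuous.
      obtain ⟨y, hy⟩ : ∃ y, ∀ j ∈ N, y ∈ N ∧ f y ≤ f j := by
        by_cases hN : N.Nonempty
        · obtain ⟨y, hyN, hy⟩ := N.exists_min_image f hN
          exact ⟨y, fun j hj => ⟨hyN, hy j hj⟩⟩
        · exact ⟨a, fun j hj => absurd ⟨j, hj⟩ hN⟩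
      set b' := Function.update b s₀.succ y
      have hne : ∀ t : Fin d, t < s₀ → b' t.succ = b t.succ := fun t ht =>
        Function.update_of_ne (by rw [Ne, Fin.succ_inj]; exact ht.ne) _ _
      have h0 : b' 0 = b 0 := Function.update_of_ne (Fin.succ_ne_zero _).symm _ _
      have hnear : ∀ s ≤ s₀, nearFlag η (X ∘ b') s = nearFlag η (X ∘ b) s := fun s hs =>
        nearFlag_congr (congrArg X h0) fun t ht => congrArg X (hne t (ht.trans_le hs))
      refine ⟨b', h0.trans hb0, fun s hs j hj hjn => ?_⟩
      rcases (show s ≤ s₀ from Fin.le_def.2 (by simp [s₀]; omega)).lt_or_eq with h | h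
      · rw [hnear s h.le] at hjn ⊢
        rw [hne s h]
        exact hb s (Fin.lt_def.1 h) j hj hjn
      · subst h
        rw [hnear _ le_rfl] at hjn ⊢
        have hy' : b' s₀.succ = y := Function.update_self _ _ _
        have := hy j (Finset.mem_filter.2 ⟨hj, hjn⟩)
        rw [hy']
        exact ⟨(Finset.mem_filter.1 this.1).1, (Finset.mem_filter.1 this.1).2, this.2⟩
  obtain ⟨b, hb0, hb⟩ := hstep d le_rfl
  refine ⟨b, fun V hVA ⟨j₀, hj₀⟩ hV => ?_⟩
  have hs : ∀ s : Fin d, ∀ j ∈ V, _ := fun s j hj => hb s s.2 j (hVA hj) (hV j hj s)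
  refine ⟨fun s => ?_, fun s j hj => ?_, ?_⟩
  · refine Fin.cases ?_ (fun s => ?_) s
    · rw [hb0]; exact haA
    · exact (hs s j₀ hj₀).1
  · refine Fin.cases ?_ (fun s => ?_) s
    · rw [hb0]; exact ha j (hVA hj)
    · exact (hs s j hj).2.2
  · have : ∀ s : Fin d, ∃ e : Pt d, ‖e‖ = 1 ∧
        (∀ t < s, inner ℝ ((X ∘ b) t.succ - (X ∘ b) 0) e = 0) ∧
        η ≤ |inner ℝ (X (b s.succ) - (X ∘ b) 0) e| := by
      intro s
      have := (hs s j₀ hj₀).2.1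
      simp only [nearFlag, Set.mem_ofPred_eq] at this
      push Not at this
      obtain ⟨e, h1, h2, h3⟩ := this
      exact ⟨e, h1, h2, h3⟩
    choose e h1 h2 h3 using this
    exact ⟨e, h1, h2, h3⟩

/-! ### From few bad points to a forced label. -/

/-- A finite set with more than `K` elements can be listed in the order of a function. -/
theorem exists_monotone_enum {ι : Type*} (V : Finset ι) (f : ι → ℝ) {K : ℕ} (hK : K < V.card) :
    ∃ u : ℕ → ι, (∀ i, u i ∈ V) ∧ (∀ i ≤ K, ∀ j ≤ K, u i = u j → i = j) ∧
      ∀ i ≤ K, ∀ j ≤ K, i ≤ j → f (u i) ≤ f (u j) := by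
  set E := V.equivFin.symm
  set σ := Tuple.sort fun i => f (E i)
  have hmono : Monotone ((fun i => f (E i)) ∘ σ) := Tuple.monotone_sort _
  refine ⟨fun i => E (σ ⟨min i K, by omega⟩), fun i => (E _).2, fun i hi j hj h => ?_,
    fun i hi j hj hij => hmono (Fin.mk_le_mk.2 (by omega))⟩
  have := σ.injective (E.injective (Subtype.ext h))
  rw [Fin.mk.injEq] at this
  omega

theorem SameAnswers.pos {X : Type*} {T : Set X} {h g : X → ℝ} (hg : SameAnswers T h g) {x : X}
    (hx : x ∈ T) (hpos : 0 < h x) : 0 < g x := by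
  have := hg.1 x hx
  rwa [sign_pos hpos, sign_eq_one_iff] at this

theorem SameAnswers.le {X : Type*} {T : Set X} {h g : X → ℝ} (hg : SameAnswers T h g) {x y : X}
    (hx : x ∈ T) (hy : y ∈ T) (hle : h x ≤ h y) : g x ≤ g y := by
  by_contra hlt
  have := hg.2 x hx y hy
  rw [sign_pos (sub_pos.2 (not_le.1 hlt)), eq_comm, sign_eq_one_iff] at this
  linarith

theorem SameAnswers.neg {X : Type*} {T : Set X} {h g : X → ℝ} (hg : SameAnswers T h g) :
    SameAnswers T (-h) (-g) := by
  refine ⟨fun x hx => ?_, fun x hx y hy => ?_⟩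
  · simp [Left.sign_neg, hg.1 x hx]
  · have := hg.2 y hy x hx
    simpa [neg_add_eq_sub] using this

/-- If few points are bad and many points are on the positive side of `h`, then the label of one of
these is forced by the answers on the other points. -/
theorem exists_forced_pos_of_card {d : ℕ} (hd : 1 ≤ d) {n k K : ℕ} {η R : ℝ} (hη : 0 < η)
    (hR : 0 ≤ R) (X : Fin n → Pt d) (h : Pt d → ℝ)
    (hbad : ∀ (b : Fin (d + 1) → Fin n) (J : Finset (Fin n)),
      (∀ j ∈ J, j ∉ Set.range b ∧ X j ∈ badRegion η R h (X ∘ b)) → J.card < k)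
    (A : Finset (Fin n)) (hAR : ∀ j ∈ A, ‖X j‖ ≤ R) (hApos : ∀ j ∈ A, 0 < h (X j))
    (hAcard : k + (d + 1) + K < A.card)
    (hcard : (2 * (K * (2 * R) + R)) ^ d < 2 ^ K * (η * (1 / (2 * d))) ^ d) :
    ∃ p ∈ A, ∀ g : Pt d →ᵃ[ℝ] ℝ, SameAnswers (X '' {j | j ≠ p}) h g → 0 < g (X p) := by
  classical
  have hd0 : (0 : ℝ) < d := by exact_mod_cast hd
  obtain ⟨b, hb⟩ := exists_greedy_flag η X (fun j => h (X j)) A (Finset.card_pos.1 (by omega))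
  set V := A.filter fun j => j ∉ Set.range b ∧ ∀ s, X j ∉ nearFlag η (X ∘ b) s
  set J := A.filter fun j => j ∉ Set.range b ∧ ∃ s, X j ∈ nearFlag η (X ∘ b) s
  have hJ : J.card < k := hbad b J fun j hj => by
    have := (Finset.mem_filter.1 hj).2
    exact ⟨this.1, Or.inr (Or.inr this.2)⟩
  have hV : K < V.card := by
    have hsub : A ⊆ V ∪ (J ∪ Finset.univ.image b) := by
      intro j hj
      simp only [Finset.mem_union, V, J, Finset.mem_filter, Finset.mem_image, Finset.mem_univ,
        true_and, hj, Set.mem_range]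
      by_cases h1 : ∃ y, b y = j
      · exact Or.inr (Or.inr h1)
      · by_cases h2 : ∃ s, X j ∈ nearFlag η (X ∘ b) s
        · exact Or.inr (Or.inl ⟨h1, h2⟩)
        · exact Or.inl ⟨h1, fun s hs => h2 ⟨s, hs⟩⟩
    have h1 := Finset.card_le_card hsub
    have h2 := Finset.card_union_le V (J ∪ Finset.univ.image b)
    have h3 := Finset.card_union_le J (Finset.univ.image b)
    have h4 : (Finset.univ.image b).card ≤ d + 1 := by
      simpa using Finset.card_image_le (s := Finset.univ) (f := b)
    omega
  have hVA : V ⊆ A := Finset.filter_subset _ _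
  obtain ⟨hbA, hbV, e, he⟩ := hb V hVA (Finset.card_pos.1 (by omega)) fun j hj =>
    (Finset.mem_filter.1 hj).2.2
  obtain ⟨u, huV, hinj, hmono⟩ := exists_monotone_enum V (fun j => h (X j)) hV
  have hmul : (d : ℝ) * (2 * R * (1 / (2 * d))) = R := by field_simp
  -- `ε = 1 / (2 d)` makes the `d` edge coefficients sum to at most `1 / 2`.
  obtain ⟨α, hα, hne, β, hβ, hrel⟩ := he.exists_sign_relation (ε := 1 / (2 * d)) (r := 2 * R) hη hR
    (by positivity) (by positivity) (fun s => hAR _ (hbA s)) (K := K)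
    (fun i => X (u (i + 1)) - X (u i))
    (fun i _ => (norm_sub_le _ _).trans (by
      linarith [hAR _ (hVA (huV i)), hAR _ (hVA (huV (i + 1)))]))
    (by rw [hmul]; exact hcard)
  have hβ' : ∑ s, |β s| ≤ 1 / 2 := by
    refine (Finset.sum_le_card_nsmul _ _ _ fun s _ => hβ s).trans ?_
    rw [Finset.card_univ, Fintype.card_fin, nsmul_eq_mul]
    field_simp
    exact le_rfl
  obtain ⟨p, hp, hforce⟩ := exists_forced_pos (v := fun i => X (u i)) hα hne hβ' hrel
  refine ⟨u p, hVA (huV p), fun g hg => ?_⟩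
  have hdec : ∀ x, g x = g.linear x + g 0 := fun x => congrFun g.decomp x
  -- `V` avoids the range of `b`, so removing `u p` keeps every flag vertex.
  have hbT : ∀ s, X (b s) ∈ X '' {j | j ≠ u p} := fun s =>
    ⟨b s, fun h => ((Finset.mem_filter.1 (huV p)).2.1) ⟨s, h⟩, rfl⟩
  have huT : ∀ i ≤ K, i ≠ p → X (u i) ∈ X '' {j | j ≠ u p} := fun i hi hip =>
    ⟨u i, fun h => hip (hinj i hi p hp h), rfl⟩
  rw [hdec]
  refine hforce g.linear (g 0) (fun s => ?_) (fun s i hi hip => ?_) fun i hi j hj hip hjp hij => ?_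
  · rw [Function.comp_apply, ← hdec]
    exact hg.pos (hbT s) (hApos _ (hbA s))
  · have := hg.le (hbT s) (huT i hi hip) (hbV s _ (huV i))
    rw [hdec, hdec (X (u i))] at this
    simpa using this
  · have := hg.le (huT i hi hip) (huT j hj hjp) (hmono i hi j hj hij)
    rw [hdec, hdec (X (u j))] at this
    simpa using this

/-- If few points are bad, then the label of some point is forced by the answers on the others. -/
theorem exists_forced_of_few_bad {d : ℕ} (hd : 1 ≤ d) {n k K : ℕ} {η R : ℝ} (hη : 0 < η)
    (hR : 0 ≤ R) (X : Fin n → Pt d) (h : Pt d → ℝ)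
    (hbad : ∀ (b : Fin (d + 1) → Fin n) (J : Finset (Fin n)),
      (∀ j ∈ J, j ∉ Set.range b ∧ X j ∈ badRegion η R h (X ∘ b)) → J.card < k)
    (hn : 3 * (k + (d + 1)) + 2 * (K + 1) ≤ n)
    (hcard : (2 * (K * (2 * R) + R)) ^ d < 2 ^ K * (η * (1 / (2 * d))) ^ d) :
    ∃ p, ∀ g : Pt d →ᵃ[ℝ] ℝ, SameAnswers (X '' {j | j ≠ p}) h g →
      SignType.sign (g (X p)) = SignType.sign (h (X p)) := by
  classical
  set P := Finset.univ.filter fun j => ‖X j‖ ≤ R ∧ 0 < h (X j)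
  set N := Finset.univ.filter fun j => ‖X j‖ ≤ R ∧ h (X j) < 0
  have hsum : n < P.card + N.card + k + (d + 1) := by
    -- Any tuple will do: only the parts of the bad region independent of `b` matter here.
    set b : Fin (d + 1) → Fin n := fun _ => ⟨0, by omega⟩
    set J := Finset.univ.filter fun j => j ∉ Set.range b ∧ (R < ‖X j‖ ∨ h (X j) = 0)
    have hJ : J.card < k := hbad b J fun j hj => by
      have := (Finset.mem_filter.1 hj).2
      exact ⟨this.1, this.2.imp_right Or.inl⟩
    have hsub : Finset.univ ⊆ P ∪ (N ∪ (J ∪ Finset.univ.image b)) := by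
      intro j _
      simp only [Finset.mem_union, P, N, J, Finset.mem_filter, Finset.mem_image, Finset.mem_univ,
        true_and, Set.mem_range]
      by_cases h1 : ∃ y, b y = j
      · exact Or.inr (Or.inr (Or.inr h1))
      · rcases lt_or_ge R ‖X j‖ with h2 | h2
        · exact Or.inr (Or.inr (Or.inl ⟨h1, Or.inl h2⟩))
        · rcases lt_trichotomy (h (X j)) 0 with h3 | h3 | h3
          · exact Or.inr (Or.inl ⟨h2, h3⟩)
          · exact Or.inr (Or.inr (Or.inl ⟨h1, Or.inr h3⟩))
          · exact Or.inl ⟨h2, h3⟩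
    have h1 := Finset.card_le_card hsub
    have h2 := Finset.card_union_le P (N ∪ (J ∪ Finset.univ.image b))
    have h3 := Finset.card_union_le N (J ∪ Finset.univ.image b)
    have h4 := Finset.card_union_le J (Finset.univ.image b)
    have h5 : (Finset.univ.image b).card ≤ d + 1 := by
      simpa using Finset.card_image_le (s := Finset.univ) (f := b)
    simp only [Finset.card_univ, Fintype.card_fin] at h1
    omega
  rcases (by omega : k + (d + 1) + K < P.card ∨ k + (d + 1) + K < N.card) with hP | hN
  · obtain ⟨p, hp, hforce⟩ := exists_forced_pos_of_card hd hη hR X h hbad P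
      (fun j hj => (Finset.mem_filter.1 hj).2.1) (fun j hj => (Finset.mem_filter.1 hj).2.2) hP hcard
    refine ⟨p, fun g hg => ?_⟩
    rw [sign_pos (hforce g hg), sign_pos (Finset.mem_filter.1 hp).2.2]
  · obtain ⟨p, hp, hforce⟩ := exists_forced_pos_of_card hd hη hR X (-h)
      (fun b J hJ => hbad b J fun j hj => by simpa [badRegion] using hJ j hj) N
      (fun j hj => (Finset.mem_filter.1 hj).2.1)
      (fun j hj => by simpa using (Finset.mem_filter.1 hj).2.2) hN hcard
    refine ⟨p, fun g hg => ?_⟩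
    have := hforce (-g) (by simpa using hg.neg)
    rw [sign_neg (by simpa using this), sign_neg (Finset.mem_filter.1 hp).2.2]


/-! ### Measurability and measure of the bad region. -/

/-- The complement is the projection, along the compact unit sphere, of a closed set of witnessing
directions. Joint openness in flag and point supplies the measurability needed for Tonelli. -/
theorem isOpen_setOf_mem_nearFlag {d : ℕ} (η : ℝ) (s : Fin d) :
    IsOpen {z : (Fin (d + 1) → Pt d) × Pt d | z.2 ∈ nearFlag η z.1 s} := by
  set F : Set (Metric.sphere (0 : Pt d) 1 × ((Fin (d + 1) → Pt d) × Pt d)) :=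
    {w | (∀ t < s, inner ℝ (w.2.1 t.succ - w.2.1 0) (w.1 : Pt d) = 0) ∧
      η ≤ |inner ℝ (w.2.2 - w.2.1 0) (w.1 : Pt d)|}
  have hF : IsClosed F := by
    have h1 : ∀ t : Fin d, IsClosed {w : Metric.sphere (0 : Pt d) 1 × ((Fin (d + 1) → Pt d) × Pt d) |
        t < s → inner ℝ (w.2.1 t.succ - w.2.1 0) (w.1 : Pt d) = 0} := fun t => by
      by_cases ht : t < s
      · simp only [ht, true_imp_iff]
        exact isClosed_eq (by fun_prop) continuous_const
      · simp [ht]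
    have h2 : IsClosed {w : Metric.sphere (0 : Pt d) 1 × ((Fin (d + 1) → Pt d) × Pt d) |
        η ≤ |inner ℝ (w.2.2 - w.2.1 0) (w.1 : Pt d)|} :=
      isClosed_le continuous_const (by fun_prop)
    convert (isClosed_iInter h1).inter h2 using 1
    ext w
    simp [F]
  have hcl := isClosedMap_snd_of_compactSpace F hF
  rw [← isClosed_compl_iff]
  convert hcl using 1
  ext z
  simp only [nearFlag, Set.mem_compl_iff, Set.mem_ofPred_eq, Set.mem_image, F]
  push Not
  constructor
  · rintro ⟨e, h1, h2, h3⟩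
    exact ⟨⟨⟨e, by simpa using h1⟩, z⟩, ⟨h2, h3⟩, rfl⟩
  · rintro ⟨⟨⟨e, h1⟩, _⟩, ⟨h2, h3⟩, rfl⟩
    exact ⟨e, by simpa using h1, h2, h3⟩

theorem measurableSet_setOf_mem_badRegion {d : ℕ} (η R : ℝ) {h : Pt d → ℝ} (hh : Continuous h) :
    MeasurableSet {z : (Fin (d + 1) → Pt d) × Pt d | z.2 ∈ badRegion η R h z.1} := by
  have : {z : (Fin (d + 1) → Pt d) × Pt d | z.2 ∈ badRegion η R h z.1}
      = {z | R < ‖z.2‖} ∪ ({z | h z.2 = 0} ∪ ⋃ s, {z | z.2 ∈ nearFlag η z.1 s}) := by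
    ext z
    simp [badRegion]
  rw [this]
  refine (isOpen_lt continuous_const (by fun_prop)).measurableSet.union
    ((isClosed_eq (by fun_prop) continuous_const).measurableSet.union ?_)
  exact (isOpen_iUnion fun s => isOpen_setOf_mem_nearFlag η s).measurableSet

theorem exists_unit_inner_eq_zero {d : ℕ} (s : Fin d) (u : Fin d → Pt d) :
    ∃ e : Pt d, ‖e‖ = 1 ∧ ∀ t < s, inner ℝ (u t) e = 0 := by
  classical
  set W := Submodule.span ℝ (((Finset.Iio s).image u : Finset (Pt d)) : Set (Pt d))
  have hW : Module.finrank ℝ W < d := by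
    refine (finrank_span_finset_le_card _).trans_lt (Finset.card_image_le.trans_lt ?_)
    simp
  have hWo : Wᗮ ≠ ⊥ := by
    intro h
    have := W.finrank_add_finrank_orthogonal
    rw [h, finrank_bot, finrank_euclideanSpace, Fintype.card_fin] at this
    omega
  obtain ⟨e, he, hne⟩ := Submodule.exists_mem_ne_zero_of_ne_bot hWo
  refine ⟨‖e‖⁻¹ • e, by simp [norm_smul, hne], fun t ht => ?_⟩
  rw [real_inner_smul_right, (W.mem_orthogonal e).1 he (u t)
    (Submodule.subset_span (by simpa using ⟨t, ht, rfl⟩)), mul_zero]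

/-- A single admissible direction already traps the region in a slab of half-width `η`. -/
theorem measureReal_nearFlag_le {d : ℕ} {D : MeasureTheory.Measure (Pt d)}
    [MeasureTheory.IsProbabilityMeasure D] {c η : ℝ} (hη : 0 < η) (hD : AntiConcentrated D c)
    (b : Fin (d + 1) → Pt d) (s : Fin d) : D.real (nearFlag η b s) ≤ c * η := by
  obtain ⟨e, he, hbe⟩ := exists_unit_inner_eq_zero s fun t => b t.succ - b 0
  refine le_trans (MeasureTheory.measureReal_mono fun x hx => ?_)
    (hD η hη (fun x => inner ℝ x e + -inner ℝ (b 0) e) ⟨e, _, he, rfl⟩)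
  have := hx e he hbe
  rw [inner_sub_left, sub_eq_add_neg] at this
  exact this.le

theorem measureReal_badRegion_le {d : ℕ} {D : MeasureTheory.Measure (Pt d)}
    [MeasureTheory.IsProbabilityMeasure D] {c₁ c₂ η a : ℝ} (hη : 0 < η) (ha : 0 < a)
    (hD₁ : Concentrated D c₁) (hD₂ : AntiConcentrated D c₂) {h : Pt d → ℝ}
    (hh : D.real {x | h x = 0} ≤ c₂ * η) (b : Fin (d + 1) → Pt d) :
    D.real (badRegion η (d * a) h b) ≤ c₁ / a + (d + 1) * (c₂ * η) := by
  have : badRegion η (d * a) h b = {x | d * a < ‖x‖} ∪ ({x | h x = 0} ∪ ⋃ s, nearFlag η b s) := by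
    ext x
    simp [badRegion]
  rw [this]
  refine (MeasureTheory.measureReal_union_le _ _).trans (add_le_add (hD₁ a ha) ?_)
  refine (MeasureTheory.measureReal_union_le _ _).trans ?_
  have h2 : D.real (⋃ s, nearFlag η b s) ≤ d * (c₂ * η) := by
    refine (MeasureTheory.measureReal_iUnion_fintype_le _).trans ?_
    refine (Finset.sum_le_card_nsmul _ _ _ fun s _ => measureReal_nearFlag_le hη hD₂ b s).trans ?_
    simp
  linarith

/-! ### Conditioning and the union bound. -/

/-- The probability that all points indexed by `J` lie in a set of conditional probability at most
`q` given sample points outside `J`. -/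
theorem pi_measure_forall_mem_le {E ι κ : Type*} [MeasurableSpace E] [Fintype ι]
    (D : MeasureTheory.Measure E) [MeasureTheory.IsProbabilityMeasure D] {W : Set ((κ → E) × E)}
    (hW : MeasurableSet W) {q : ENNReal} (hq : ∀ b, D {x | (b, x) ∈ W} ≤ q) (u : κ → ι)
    (J : Finset ι) (hJ : ∀ a, u a ∉ J) :
    MeasureTheory.Measure.pi (fun _ : ι => D) {X | ∀ j ∈ J, (X ∘ u, X j) ∈ W} ≤ q ^ J.card := by
  classical
  obtain ⟨p, hp⟩ : ∃ p : ι → Prop, ∀ i, p i ↔ i ∈ J := ⟨_, fun _ => Iff.rfl⟩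
  have hJ' : ∀ a, ¬p (u a) := fun a => by rw [hp]; exact hJ a
  set S : Set (({i // p i} → E) × ({i // ¬p i} → E)) :=
    {z | ∀ j : {i // p i}, ((fun a => z.2 ⟨u a, hJ' a⟩), z.1 j) ∈ W}
  have hS : MeasurableSet S := by
    have : S = ⋂ j : {i // p i}, (fun z : ({i // p i} → E) × ({i // ¬p i} → E) =>
        ((fun a => z.2 ⟨u a, hJ' a⟩), z.1 j)) ⁻¹' W := by
      ext z
      simp [S]
    rw [this]
    refine MeasurableSet.iInter fun j => hW.preimage ?_
    refine Measurable.prodMk (measurable_pi_lambda _ fun a => ?_) ?_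
    · exact (measurable_pi_apply _).comp measurable_snd
    · exact (measurable_pi_apply _).comp measurable_fst
  have hmp := MeasureTheory.measurePreserving_piEquivPiSubtypeProd (fun _ : ι => D) p
  have hpre : {X : ι → E | ∀ j ∈ J, (X ∘ u, X j) ∈ W}
      = MeasurableEquiv.piEquivPiSubtypeProd (fun _ : ι => E) p ⁻¹' S := by
    ext X
    simp [S, ← hp, MeasurableEquiv.piEquivPiSubtypeProd, Equiv.piEquivPiSubtypeProd, Function.comp_def]
  rw [hpre, hmp.measure_preimage hS.nullMeasurableSet, MeasureTheory.Measure.prod_apply_symm hS]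
  refine (MeasureTheory.lintegral_mono (g := fun _ => q ^ J.card) fun y => ?_).trans (by simp)
  -- With the coordinates outside `J` fixed, the event is a product over `J`.
  have hbox : (fun x => (x, y)) ⁻¹' S
      = Set.univ.pi fun _ : {i // p i} => {x | ((fun a => y ⟨u a, hJ' a⟩), x) ∈ W} := by
    ext x
    simp [S]
  beta_reduce
  rw [hbox, MeasureTheory.Measure.pi_pi]
  refine (Finset.prod_le_pow_card _ _ q fun j _ => hq _).trans ?_
  rw [Finset.card_univ, Fintype.card_of_subtype J fun x => (hp x).symm]

/-- The probability that some tuple of sample points has `k` bad points. -/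
theorem pi_measure_exists_bad_le {E : Type*} [MeasurableSpace E] {n m : ℕ}
    (D : MeasureTheory.Measure E) [MeasureTheory.IsProbabilityMeasure D] {W : Set ((Fin m → E) × E)}
    (hW : MeasurableSet W) {q : ENNReal} (hq : ∀ b, D {x | (b, x) ∈ W} ≤ q) (k : ℕ) :
    MeasureTheory.Measure.pi (fun _ : Fin n => D)
      {X | ∃ (u : Fin m → Fin n) (J : Finset (Fin n)), J.card = k ∧
        ∀ j ∈ J, j ∉ Set.range u ∧ (X ∘ u, X j) ∈ W} ≤ n ^ m * 2 ^ n * q ^ k := by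
  classical
  have hsub : {X : Fin n → E | ∃ (u : Fin m → Fin n) (J : Finset (Fin n)), J.card = k ∧
        ∀ j ∈ J, j ∉ Set.range u ∧ (X ∘ u, X j) ∈ W} ⊆
      ⋃ a : (Fin m → Fin n) × Finset (Fin n), {X | a.2.card = k ∧
        ∀ j ∈ a.2, j ∉ Set.range a.1 ∧ (X ∘ a.1, X j) ∈ W} := by
    rintro X ⟨u, J, h⟩
    exact Set.mem_iUnion.2 ⟨(u, J), h⟩
  refine (MeasureTheory.measure_mono hsub).trans
    ((MeasureTheory.measure_iUnion_fintype_le _ _).trans ?_)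
  refine (Finset.sum_le_card_nsmul _ _ (q ^ k) fun a _ => ?_).trans ?_
  -- If `J` meets the tuple the event is empty, so independence is needed only off the tuple.
  · by_cases h : a.2.card = k ∧ ∀ i, a.1 i ∉ a.2
    · rw [← h.1]
      refine (MeasureTheory.measure_mono fun X hX => ?_).trans
        (pi_measure_forall_mem_le D hW hq a.1 a.2 h.2)
      exact fun j hj => (hX.2 j hj).2
    · suffices hempty : {X : Fin n → E | a.2.card = k ∧
          ∀ j ∈ a.2, j ∉ Set.range a.1 ∧ (X ∘ a.1, X j) ∈ W} = ∅ by
        rw [hempty, MeasureTheory.measure_empty]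
        exact bot_le
      refine Set.eq_empty_of_forall_notMem fun X hX => h ⟨hX.1, fun i hi => ?_⟩
      exact (hX.2 _ hi).1 ⟨i, rfl⟩
  · simp


/-- Every affine function on the sample agreeing with `h` on the other points has the label of `h`
at some point, except with small probability. -/
theorem pi_measure_not_forced_le {d : ℕ} (hd : 1 ≤ d) {n k K : ℕ} {c₁ c₂ η a : ℝ} (hη : 0 < η)
    (ha : 0 < a) (D : MeasureTheory.Measure (Pt d)) [MeasureTheory.IsProbabilityMeasure D]
    (hD₁ : Concentrated D c₁) (hD₂ : AntiConcentrated D c₂) (h : Pt d →ᵃ[ℝ] ℝ)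
    (hh : D.real {x | h x = 0} ≤ c₂ * η)
    (hn : 3 * (k + (d + 1)) + 2 * (K + 1) ≤ n)
    (hcard : (2 * (K * (2 * (d * a)) + d * a)) ^ d < 2 ^ K * (η * (1 / (2 * d))) ^ d) :
    MeasureTheory.Measure.pi (fun _ : Fin n => D)
      {X | ¬ ∃ p, ∀ g : Pt d →ᵃ[ℝ] ℝ, SameAnswers (X '' {j | j ≠ p}) h g →
        SignType.sign (g (X p)) = SignType.sign (h (X p))}
      ≤ n ^ (d + 1) * 2 ^ n * ENNReal.ofReal (c₁ / a + (d + 1) * (c₂ * η)) ^ k := by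
  refine (MeasureTheory.measure_mono fun X hX => ?_).trans
    (pi_measure_exists_bad_le D (measurableSet_setOf_mem_badRegion η (d * a)
      h.continuous_of_finiteDimensional) (fun b => ?_) k)
  · by_contra hgood
    refine hX (exists_forced_of_few_bad hd hη (by positivity) X h (fun b J hJ => ?_) hn hcard)
    by_contra hk
    obtain ⟨J', hJ', hcardJ⟩ := Finset.exists_subset_card_eq (not_lt.1 hk)
    exact hgood ⟨b, J', hcardJ, fun j hj => hJ j (hJ' hj)⟩
  · rw [← MeasureTheory.ofReal_measureReal]
    exact ENNReal.ofReal_le_ofReal (measureReal_badRegion_le hη ha hD₁ hD₂ hh b)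

/-! ### Transport along the affine equivalence. -/

/-- A hyperplane pulled back along an affine equivalence is an affine function whose zero set is
that of a hyperplane. -/
theorem exists_hyperplane_zero_iff {d : ℕ} (f : Pt d ≃ᵃ[ℝ] Pt d) {h : Pt d → ℝ}
    (hh : h ∈ hyperplanes d) :
    ∃ g : Pt d →ᵃ[ℝ] ℝ, (∀ x, g (f x) = h x) ∧
      ∃ h' ∈ hyperplanes d, ∀ y, g y = 0 → h' y = 0 := by
  obtain ⟨v, b, hv, rfl⟩ := hh
  set h₀ : Pt d →ᵃ[ℝ] ℝ := ((innerSL ℝ v : Pt d →L[ℝ] ℝ) : Pt d →ₗ[ℝ] ℝ).toAffineMap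
    + AffineMap.const ℝ (Pt d) b
  have hh₀ : ∀ x, h₀ x = inner ℝ x v + b := fun x => by
    simp [h₀, real_inner_comm]
  set g : Pt d →ᵃ[ℝ] ℝ := h₀.comp (f.symm : Pt d →ᵃ[ℝ] Pt d)
  have hg : ∀ x, g (f x) = inner ℝ x v + b := fun x => by
    rw [← hh₀]; simp [g]
  refine ⟨g, hg, ?_⟩
  set w : Pt d := (InnerProductSpace.toDual ℝ (Pt d)).symm (LinearMap.toContinuousLinearMap g.linear)
  have hw : ∀ y, g y = inner ℝ y w + g 0 := fun y => by
    rw [real_inner_comm, InnerProductSpace.toDual_symm_apply]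
    exact congrFun g.decomp y
  -- A zero gradient would make `g` constant, yet `g (f v)` and `g (f 0)` differ by `‖v‖ ^ 2 = 1`.
  have hw0 : w ≠ 0 := by
    intro h0
    have h1 := hg v; have h2 := hg 0
    rw [hw, h0, inner_zero_right, zero_add] at h1 h2
    rw [h1, real_inner_self_eq_norm_sq, hv, inner_zero_left] at h2
    norm_num at h2
  refine ⟨_, ⟨‖w‖⁻¹ • w, ‖w‖⁻¹ * g 0, by simp [norm_smul, hw0], rfl⟩, fun y hy => ?_⟩
  rw [hw] at hy
  change inner ℝ y (‖w‖⁻¹ • w) + ‖w‖⁻¹ * g 0 = 0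
  rw [real_inner_smul_right, ← mul_add, hy, mul_zero]

theorem exists_affineMap_comp_eq {d : ℕ} (f : Pt d ≃ᵃ[ℝ] Pt d) {h : Pt d → ℝ}
    (hh : h ∈ hyperplanes d) : ∃ g : Pt d →ᵃ[ℝ] ℝ, ∀ x, g (f x) = h x :=
  (exists_hyperplane_zero_iff f hh).imp fun _ h => h.1

theorem SameAnswers.of_comp {X Y : Type*} {T : Set X} {f : X → Y} {h h' : X → ℝ} {g g' : Y → ℝ}
    (hg : ∀ x, g (f x) = h x) (hg' : ∀ x, g' (f x) = h' x) (hs : SameAnswers T h h') :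
    SameAnswers (f '' T) g g' := by
  refine ⟨?_, ?_⟩
  · rintro _ ⟨x, hx, rfl⟩
    rw [hg, hg']; exact hs.1 x hx
  · rintro _ ⟨x, hx, rfl⟩ _ ⟨y, hy, rfl⟩
    rw [hg, hg', hg, hg']; exact hs.2 x hx y hy

/-- The bound on the probability that no point is inferred, for a distribution that is affinely
equivalent to a concentrated and anti-concentrated one. -/
theorem pi_measureReal_not_infers_le {d : ℕ} (hd : 1 ≤ d) {n k K : ℕ} {c₁ c₂ η a : ℝ} (hη : 0 < η)
    (ha : 0 < a) (D D' : MeasureTheory.Measure (Pt d)) [MeasureTheory.IsProbabilityMeasure D]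
    (hDD' : AffinelyEquivalent D D') (hD₁ : Concentrated D' c₁) (hD₂ : AntiConcentrated D' c₂)
    {h : Pt d → ℝ} (hh : h ∈ hyperplanes d)
    (hn : 3 * (k + (d + 1)) + 2 * (K + 1) ≤ n)
    (hcard : (2 * (K * (2 * (d * a)) + d * a)) ^ d < 2 ^ K * (η * (1 / (2 * d))) ^ d)
    (hq : 0 ≤ c₁ / a + (d + 1) * (c₂ * η)) :
    (MeasureTheory.Measure.pi (fun _ : Fin n => D)).real
      {S : Fin n → Pt d | ¬ ∃ i, Infers (hyperplanes d) h (S '' {j | j ≠ i}) (S i)}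
      ≤ n ^ (d + 1) * 2 ^ n * (c₁ / a + (d + 1) * (c₂ * η)) ^ k := by
  obtain ⟨f, rfl⟩ := hDD'
  have hf : Measurable f := (f : Pt d →ᵃ[ℝ] Pt d).continuous_of_finiteDimensional.measurable
  have : MeasureTheory.IsProbabilityMeasure (D.map f) :=
    MeasureTheory.Measure.isProbabilityMeasure_map hf.aemeasurable
  obtain ⟨g, hg, h', hh', hzero⟩ := exists_hyperplane_zero_iff f hh
  have hg0 : (D.map f).real {x | g x = 0} ≤ c₂ * η := by
    refine (MeasureTheory.measureReal_mono fun x hx => ?_).trans (hD₂ η hη h' hh')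
    change |h' x| ≤ η
    rw [hzero x hx, abs_zero]
    exact hη.le
  have hmain := pi_measure_not_forced_le hd hη ha (D.map f) hD₁ hD₂ g hg0 hn hcard
  rw [← MeasureTheory.Measure.pi_map_pi fun _ => hf.aemeasurable] at hmain
  have hF : Measurable fun (S : Fin n → Pt d) i => f (S i) :=
    measurable_pi_lambda _ fun i => hf.comp (measurable_pi_apply i)
  -- This inequality holds for arbitrary sets, so the failure event need not be measurable.
  have hle := (MeasureTheory.Measure.le_map_apply hF.aemeasurable _).trans hmain
  have hle' := (MeasureTheory.measure_mono (fun S (hS : ¬ ∃ i,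
    Infers (hyperplanes d) h (S '' {j | j ≠ i}) (S i)) => ?_)).trans hle
  · refine (ENNReal.toReal_mono (by finiteness) hle').trans_eq ?_
    simp [ENNReal.toReal_ofReal hq]
  · rintro ⟨p, hp⟩
    refine hS ⟨p, fun h₁ hh₁ hs => ?_⟩
    obtain ⟨g₁, hg₁⟩ := exists_affineMap_comp_eq f hh₁
    have := hp g₁ (by
      have := hs.of_comp hg hg₁
      rwa [Set.image_image] at this)
    simpa only [hg, hg₁] using this

/-! ### Numerical estimates. -/

theorem le_two_rpow {x s : ℝ} (hx : 0 < x) (h : Real.log x ≤ s * Real.log 2) :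
    x ≤ (2 : ℝ) ^ s := by
  rwa [← Real.log_le_log_iff hx (by positivity), Real.log_rpow two_pos]

theorem le_two_rpow_div {t : ℝ} (ht : 4096 ≤ t) : t ≤ (2 : ℝ) ^ (t / 256) := by
  -- Bernoulli after splitting off `2 ^ 12`: the bound becomes `4096 * (t / 256 - 11) ≥ t`.
  have h1 := one_add_mul_self_le_rpow_one_add (s := (1 : ℝ)) (by norm_num)
    (p := t / 256 - 12) (by linarith)
  have h2 : (2 : ℝ) ^ (t / 256) = 2 ^ 12 * 2 ^ (t / 256 - 12) := by
    rw [← Real.rpow_natCast, ← Real.rpow_add two_pos]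
    congr 1
    push_cast; ring
  rw [h2]
  norm_num at h1 ⊢
  linarith

/-- The growth conditions on `n / d` that follow from the hypothesis on the sample size. -/
theorem sample_size_bounds {d : ℕ} (hd : 1 ≤ d) {C n : ℝ} (hC : 2 ≤ C)
    (h : 16384 * Real.log C * (d * Real.log (d + 1) ^ 2) ≤ n) :
    4096 ≤ n / d ∧ (d + 1 : ℝ) ≤ 2 ^ (n / d / 256) ∧ C ≤ 2 ^ (n / d / 256) := by
  have hd1 : (1 : ℝ) ≤ d := by exact_mod_cast hd
  have hl2 : (0.69 : ℝ) ≤ Real.log 2 := by linarith [Real.log_two_gt_d9]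
  have hlC : 0.69 ≤ Real.log C := hl2.trans (Real.log_le_log two_pos hC)
  have hld : 0.69 ≤ Real.log ((d : ℝ) + 1) := hl2.trans (Real.log_le_log two_pos (by linarith))
  set l := Real.log ((d : ℝ) + 1)
  set c := Real.log C
  have ht : 16384 * (c * l ^ 2) ≤ n / d := by
    rw [le_div_iff₀ (by linarith)]
    linarith
  set t := n / d
  -- Each of the three logarithmic factors is at least `0.69`, and `16384 * 0.69 ^ 3 > 4096`.
  have h1 : 0.69 * c ≤ c * l := by nlinarith
  have h2 : 0.69 * l ≤ c * l := by nlinarith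
  have h3 : 0.69 * (c * l) ≤ c * l ^ 2 := by
    nlinarith [mul_nonneg (by linarith : 0 ≤ c) (by linarith : 0 ≤ l)]
  have h4 : t / 256 * 0.69 ≤ t / 256 * Real.log 2 :=
    mul_le_mul_of_nonneg_left hl2 (by linarith)
  exact ⟨by linarith, le_two_rpow (by linarith) (by linarith),
    le_two_rpow (by linarith) (by linarith)⟩


theorem natCast_le_two_rpow {d n : ℕ} (hd : 1 ≤ d) (ht : 4096 ≤ (n / d : ℝ))
    (hdt : (d + 1 : ℝ) ≤ 2 ^ (n / d / 256 : ℝ)) : (n : ℝ) ≤ 2 ^ (n / d / 128 : ℝ) := by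
  have hd0 : (0 : ℝ) < d := by exact_mod_cast hd
  have h : (n : ℝ) = d * (n / d) := by field_simp
  calc (n : ℝ) = d * (n / d) := h
    _ ≤ 2 ^ (n / d / 256 : ℝ) * 2 ^ (n / d / 256 : ℝ) :=
      mul_le_mul (by linarith) (le_two_rpow_div ht) (by positivity) (by positivity)
    _ = _ := by rw [← Real.rpow_add two_pos]; congr 1; ring

/-- The volume condition of the pigeonhole argument for `η = 2 ^ (-n / (64 d))`. -/
theorem volume_condition {d n : ℕ} (hd : 1 ≤ d) (ht : 4096 ≤ (n / d : ℝ))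
    (hdt : (d + 1 : ℝ) ≤ 2 ^ (n / d / 256 : ℝ)) :
    (2 * ((n / 4 : ℕ) * (2 * (d * (2 : ℝ) ^ (n / d / 64 : ℝ))) + d * (2 : ℝ) ^ (n / d / 64 : ℝ))) ^ d
      < 2 ^ (n / 4) * ((2 : ℝ) ^ (-(n / d / 64) : ℝ) * (1 / (2 * d))) ^ d := by
  have hd0 : (0 : ℝ) < d := by exact_mod_cast hd
  have hnt : (n : ℝ) = d * (n / d) := by field_simp
  have hn := natCast_le_two_rpow hd ht hdt
  have h4 : (4 : ℝ) ≤ 2 ^ (n / d / 256 : ℝ) := by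
    linarith [le_two_rpow_div ht]
  set t : ℝ := n / d
  set x : ℝ := 2 ^ (t / 64)
  have hx : 0 < x := by positivity
  have hK : 2 * ((n / 4 : ℕ) : ℝ) + 1 ≤ n := by
    have : 4096 ≤ (n : ℝ) := by
      rw [hnt]
      have : (1 : ℝ) ≤ d := by exact_mod_cast hd
      nlinarith
    have : ((n / 4 : ℕ) : ℝ) ≤ n / 4 := Nat.cast_div_le
    linarith
  have hKlow : (n : ℝ) / 4 - 1 < ((n / 4 : ℕ) : ℝ) := by
    have : n < 4 * (n / 4) + 4 := by omega
    have : (n : ℝ) < 4 * ((n / 4 : ℕ) : ℝ) + 4 := by exact_mod_cast this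
    linarith
  rw [Real.rpow_neg two_pos.le, show (2 : ℝ) ^ (n / 4 : ℕ) * (x⁻¹ * (1 / (2 * d))) ^ d
    = 2 ^ (n / 4 : ℕ) / (x * (2 * d)) ^ d by
      rw [one_div, ← mul_inv, inv_pow, div_eq_mul_inv], lt_div_iff₀ (by positivity),
    ← mul_pow]
  calc (2 * (((n / 4 : ℕ) : ℝ) * (2 * (d * x)) + d * x) * (x * (2 * d))) ^ d
      = (4 * (d * (d * ((2 * ((n / 4 : ℕ) : ℝ) + 1) * (x * x))))) ^ d := by ring
    -- The factors `4`, `d`, `d`, `2K + 1`, `x * x` cost `1 + 1 + 1 + 2 + 8 = 13` units of `t /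
    -- 256`; the `d`-th power stays far below `2 ^ (n / 4 - 1)`.
    _ ≤ (2 ^ (t / 256) * (2 ^ (t / 256) * (2 ^ (t / 256) * (2 ^ (t / 128) * (x * x))))) ^ d := by
      have : (d : ℝ) ≤ 2 ^ (t / 256) := by linarith
      have := hK.trans hn
      gcongr
    _ = (2 : ℝ) ^ (13 * (n : ℝ) / 256) := by
      simp only [x]
      rw [← Real.rpow_add two_pos, ← Real.rpow_add two_pos, ← Real.rpow_add two_pos,
        ← Real.rpow_add two_pos, ← Real.rpow_add two_pos, ← Real.rpow_mul_natCast two_pos.le, hnt]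
      congr 1
      ring
    _ < (2 : ℝ) ^ ((n / 4 : ℕ) : ℝ) := by
      apply Real.rpow_lt_rpow_of_exponent_lt one_lt_two
      have : (1 : ℝ) ≤ d := by exact_mod_cast hd
      nlinarith
    _ = _ := Real.rpow_natCast _ _

/-- The probability bound for `η = 2 ^ (-n / (64 d))`. -/
theorem probability_condition {d n k : ℕ} (hd : 1 ≤ d) {C q : ℝ} (hC : 0 ≤ C)
    (ht : 4096 ≤ (n / d : ℝ)) (hdt : (d + 1 : ℝ) ≤ 2 ^ (n / d / 256 : ℝ))
    (hCt : C ≤ 2 ^ (n / d / 256 : ℝ)) (hk : (n : ℝ) / 8 ≤ k) (hq0 : 0 ≤ q)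
    (hq : q ≤ (d + 1) * (C * 2 ^ (-(n / d / 64) : ℝ))) :
    (n : ℝ) ^ (d + 1) * 2 ^ n * q ^ k
      ≤ (2 : ℝ) ^ (-(1 / 4096 * ((n : ℝ) ^ 2 / (d * Real.log (d + 1))))) := by
  have hd1 : (1 : ℝ) ≤ d := by exact_mod_cast hd
  have hnt : (n : ℝ) = d * (n / d) := by field_simp
  have hsq : (n : ℝ) ^ 2 / d = n * (n / d) := by ring
  have hn := natCast_le_two_rpow hd ht hdt
  set t : ℝ := n / d
  have hn1 : (1 : ℝ) ≤ n := by rw [hnt]; nlinarith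
  have hq' : q ≤ 2 ^ (-(t / 128)) := by
    refine hq.trans ?_
    calc ((d : ℝ) + 1) * (C * 2 ^ (-(t / 64)))
        ≤ 2 ^ (t / 256) * (2 ^ (t / 256) * 2 ^ (-(t / 64))) := by gcongr
      _ = _ := by
        rw [← Real.rpow_add two_pos, ← Real.rpow_add two_pos]; congr 1; ring
  have h1 : (n : ℝ) ^ (d + 1) ≤ 2 ^ ((n : ℝ) / 64) := by
    calc (n : ℝ) ^ (d + 1) ≤ (n : ℝ) ^ (2 * d) := pow_le_pow_right₀ hn1 (by omega)
      _ ≤ (2 ^ (t / 128)) ^ (2 * d) := by gcongr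
      _ = 2 ^ ((n : ℝ) / 64) := by
        rw [← Real.rpow_mul_natCast two_pos.le, hnt]
        congr 1
        push_cast; ring
  have h2 : q ^ k ≤ 2 ^ (-(n * t / 1024)) := by
    calc q ^ k ≤ (2 ^ (-(t / 128))) ^ k := by gcongr
      _ = 2 ^ (-(t / 128 * k)) := by
        rw [← Real.rpow_mul_natCast two_pos.le]; congr 1; ring
      _ ≤ _ := by
        apply Real.rpow_le_rpow_of_exponent_le one_le_two
        nlinarith
  calc (n : ℝ) ^ (d + 1) * 2 ^ n * q ^ k
      ≤ 2 ^ ((n : ℝ) / 64) * 2 ^ (n : ℝ) * 2 ^ (-(n * t / 1024)) := by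
        rw [Real.rpow_natCast]; gcongr
    _ = 2 ^ ((n : ℝ) / 64 + n + -(n * t / 1024)) := by
        rw [← Real.rpow_add two_pos, ← Real.rpow_add two_pos]
    _ ≤ _ := by
      apply Real.rpow_le_rpow_of_exponent_le one_le_two
      -- Since `t ≥ 4096`, half of the gain `n * t / 1024` absorbs `n + n / 64`. The logarithm in
      -- the target only weakens the resulting bound.
      have hl : 1 / 2 ≤ Real.log ((d : ℝ) + 1) := by
        have := Real.log_le_log two_pos (by linarith : (2 : ℝ) ≤ d + 1)
        linarith [Real.log_two_gt_d9]
      have h3 : (n : ℝ) ^ 2 / (d * Real.log (d + 1)) ≤ 2 * (n * t) := by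
        rw [← div_div, hsq, div_le_iff₀ (by linarith)]
        have : 0 ≤ n * t := by positivity
        nlinarith
      nlinarith

theorem Concentrated.nonneg {d : ℕ} {D : MeasureTheory.Measure (Pt d)} {c : ℝ}
    (h : Concentrated D c) : 0 ≤ c := by
  simpa using MeasureTheory.measureReal_nonneg.trans (h 1 one_pos)

theorem AntiConcentrated.nonneg {d : ℕ} (hd : 1 ≤ d) {D : MeasureTheory.Measure (Pt d)} {c : ℝ}
    (h : AntiConcentrated D c) : 0 ≤ c := by
  obtain ⟨e, he, -⟩ := exists_unit_inner_eq_zero (⟨0, hd⟩ : Fin d) 0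
  simpa using MeasureTheory.measureReal_nonneg.trans (h 1 one_pos _ ⟨e, 0, he, rfl⟩)

end AvgInference

theorem mainTheorem1 :
    ∃ A : ℝ, 0 < A ∧ ∃ B : ℝ, 0 < B ∧
      ∀ (d : ℕ), 1 ≤ d → ∀ (c₁ c₂ : ℝ)
        (D : MeasureTheory.Measure (AvgInference.Pt d)) [MeasureTheory.IsProbabilityMeasure D]
        (D' : MeasureTheory.Measure (AvgInference.Pt d)),
        AvgInference.AffinelyEquivalent D D' →
        AvgInference.Concentrated D' c₁ →
        AvgInference.AntiConcentrated D' c₂ →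
        ∃ g : ℕ → ℝ,
          AvgInference.HasAverageInferenceDimension D (AvgInference.hyperplanes d) g ∧
          ∀ n : ℕ,
            A * Real.log (2 + c₁ + c₂) * ((d : ℝ) * Real.log ((d : ℝ) + 1) ^ 2) ≤ (n : ℝ) →
            g n ≤ (2 : ℝ) ^ (-(B * ((n : ℝ) ^ 2 / ((d : ℝ) * Real.log ((d : ℝ) + 1))))) := by
  classical
  refine ⟨16384, by norm_num, 1 / 4096, by norm_num, fun d hd c₁ c₂ D _ D' hDD' hD₁ hD₂ => ?_⟩
  have hc₁ := hD₁.nonneg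
  have hc₂ := hD₂.nonneg hd
  -- Below the threshold the trivial bound `1` serves.
  refine ⟨fun n => if 16384 * Real.log (2 + c₁ + c₂) * ((d : ℝ) * Real.log ((d : ℝ) + 1) ^ 2) ≤ n
    then (2 : ℝ) ^ (-(1 / 4096 * ((n : ℝ) ^ 2 / ((d : ℝ) * Real.log ((d : ℝ) + 1))))) else 1,
    fun n h hh => ?_, fun n hn => (if_pos hn).le⟩
  by_cases hn : 16384 * Real.log (2 + c₁ + c₂) * ((d : ℝ) * Real.log ((d : ℝ) + 1) ^ 2) ≤ n
  swap
  · simp only [if_neg hn]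
    exact MeasureTheory.measureReal_le_one
  simp only [if_pos hn]
  obtain ⟨ht, hdt, hCt⟩ := AvgInference.sample_size_bounds hd (by linarith) hn
  have hd0 : (0 : ℝ) < d := by exact_mod_cast hd
  have hnd : 4096 * d ≤ n := by
    rw [le_div_iff₀ hd0] at ht
    exact_mod_cast ht
  set η : ℝ := 2 ^ (-(n / d / 64) : ℝ) with hηdef
  have hη : 0 < η := by positivity
  have hinv : (2 : ℝ) ^ (n / d / 64 : ℝ) = η⁻¹ := by rw [hηdef, Real.rpow_neg two_pos.le, inv_inv]
  have hq0 : 0 ≤ c₁ / (2 : ℝ) ^ (n / d / 64 : ℝ) + (d + 1) * (c₂ * η) := by positivity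
  -- Taking `a = η⁻¹` balances both tails. The choices of `k` and `K` use about `7n / 8` points; the
  -- remaining `n / 8 ≥ 512 d` covers the `O(d)` terms.
  refine (AvgInference.pi_measureReal_not_infers_le hd hη (a := 2 ^ (n / d / 64 : ℝ))
    (k := n / 8 + 1) (K := n / 4) (by positivity) D D' hDD' hD₁ hD₂ hh (by omega)
    (AvgInference.volume_condition hd ht hdt) hq0).trans
    (AvgInference.probability_condition hd (by linarith) ht hdt hCt ?_ hq0 ?_)
  · have : n ≤ 8 * (n / 8 + 1) := by omega
    have : (n : ℝ) ≤ 8 * ((n / 8 + 1 : ℕ) : ℝ) := by exact_mod_cast this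
    linarith
  · rw [hinv, div_inv_eq_mul]
    have h1 : 0 ≤ c₁ * η := by positivity
    have h2 : 0 ≤ (d : ℝ) * (c₁ * η) := by positivity
    have h3 : 0 ≤ ((d : ℝ) + 1) * (2 * η) := by positivity
    linarith
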